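/- Let $K$ be the Klein bottle with one hole (the compact nonorientable surface of genus two with one boundary component), and let $Map(K)$ be its mapping class group: the group, under composition, of self-homeomorphisms of $K$ fixing $\partial K$ pointwise, modulo isotopies fixing $\partial K$ pointwise. Concretely, take $K$ to be the quotient of the pair of pants $P=\{z\in\mathbb{C} : |z|\le 5,\ |z-2|\ge 1,\ |z+2|\ge 1\}$ obtained by identifying $z$ with $-z$ whenever $|z-2|=1$ or $|z+2|=1$, so that $\partial K$ is the image of $\{|z|=5\}$. Let $\alpha\subset K$ be the two-sided simple closed curve that is the common image of the circles $|z\mp 2|=1$. (The image $\beta$ of $[-1,1]$ is a one-sided simple closed curve meeting $\alpha$ transversely at one point, and $K$ is a regular neighbourhood of $\alpha\cup\beta$.) Let - $t_\alpha\in Map(K)$ be the class of a Dehn twist about $\alpha$ (in either of the two directions); - $r:K\to K$ be the reflection through $\alpha$, induced by $z\mapsto -z$; it fixes $\alpha$ pointwise, interchanges the two sides of $\alpha$ and rotates $\partial K$ by $\pi$; - $y\in Map(K)$ be the $Y$-homeomorphism (crosscap slide) of Lickorish, that is, the class of $r$ followed by a half twist around $\partial K$ (either of the two possible half twists), which fixes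 $\partial K$ pointwise; - $u=t_\alpha^{-1}y\in Map(K)$ be the crosscap transposition. Then for all integers $m,n$, in the group $Map(K)$, the element $t_\alpha^{2m}y^{2n+1}$ is conjugate to $y^{2n+1}$, and the element $t_\alpha^{2m+1}y^{2n+1}$ is conjugate to $u\,y^{2n}$. -/

import Mathlib

/-! ### The mapping class group of a space relative to a subspace -/

section MappingClassGroup

variable {X : Type*} [TopologicalSpace X]

/-- The group (under composition) of self-homeomorphisms of `X` that fix `B` pointwise. -/
def HomeoRel (X : Type*) [TopologicalSpace X] (B : Set X) : Subgroup (X ≃ₜ X) where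
  carrier := {f | ∀ x ∈ B, f x = x}
  mul_mem' := by
    intro f g hf hg x hx
    have h1 : g x = x := hg x hx
    have h2 : f x = x := hf x hx
    change f (g x) = x
    rw [h1, h2]
  one_mem' := by
    intro x _
    rfl
  inv_mem' := by
    intro f hf x hx
    have h1 : f x = x := hf x hx
    change f.symm x = x
    rw [Homeomorph.symm_apply_eq, h1]

/-- `f` and `g` are isotopic relative to `B`: there is a path `F` of homeomorphisms fixing `B`
pointwise from `f` to `g` such that `(t, x) ↦ (t, F t x)` is a homeomorphism of `[0, 1] × X`. -/
def IsotopicRel {B : Set X} (f g : HomeoRel X B) : Prop :=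
  ∃ F : unitInterval → HomeoRel X B, F 0 = f ∧ F 1 = g ∧
    Continuous (fun p : unitInterval × X => (F p.1 : X ≃ₜ X) p.2) ∧
    Continuous (fun p : unitInterval × X => (F p.1 : X ≃ₜ X).symm p.2)

/-- The normal subgroup of the homeomorphisms that are isotopic to the identity. -/
def isotopicToId (X : Type*) [TopologicalSpace X] (B : Set X) : Subgroup (HomeoRel X B) where
  carrier := {f | IsotopicRel f 1}
  mul_mem' := by
    rintro f g ⟨F, F0, F1, hF, hF'⟩ ⟨G, G0, G1, hG, hG'⟩
    refine ⟨fun t => F t * G t, by simp [F0, G0], by simp [F1, G1], ?_, ?_⟩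
    · exact hF.comp (continuous_fst.prodMk hG)
    · exact hG'.comp (continuous_fst.prodMk hF')
  one_mem' := ⟨fun _ => 1, rfl, rfl, continuous_snd, continuous_snd⟩
  inv_mem' := by
    rintro f ⟨F, F0, F1, hF, hF'⟩
    exact ⟨fun t => (F t)⁻¹, by simp [F0], by simp [F1], hF', hF⟩

instance isotopicToId_normal (B : Set X) : (isotopicToId X B).Normal where
  conj_mem := by
    rintro f ⟨F, F0, F1, hF, hF'⟩ g
    refine ⟨fun t => g * F t * g⁻¹, by simp [F0], by simp [F1], ?_, ?_⟩
    · exact (g : X ≃ₜ X).continuous.comp (hF.comp (continuous_fst.prodMk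
        ((g : X ≃ₜ X).symm.continuous.comp continuous_snd)))
    · exact (g : X ≃ₜ X).continuous.comp (hF'.comp (continuous_fst.prodMk
        ((g : X ≃ₜ X).symm.continuous.comp continuous_snd)))

/-- The mapping class group of `X` relative to `B`: isotopy classes, relative to `B`, of
self-homeomorphisms of `X` that fix `B` pointwise. -/
abbrev MappingClassGroup (X : Type*) [TopologicalSpace X] (B : Set X) : Type _ :=
  HomeoRel X B ⧸ isotopicToId X B

/-- The cosets are exactly the isotopy classes. -/
theorem mappingClass_eq_iff {B : Set X} (f g : HomeoRel X B) :
    (f : MappingClassGroup X B) = (g : MappingClassGroup X B) ↔ IsotopicRel f g := by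
  rw [eq_comm, QuotientGroup.eq]
  constructor
  · rintro ⟨F, F0, F1, hF, hF'⟩
    refine ⟨fun t => g * F t, by simp [F0], by simp [F1], ?_, ?_⟩
    · exact (g : X ≃ₜ X).continuous.comp hF
    · exact hF'.comp (continuous_fst.prodMk
        ((g : X ≃ₜ X).symm.continuous.comp continuous_snd))
  · rintro ⟨F, F0, F1, hF, hF'⟩
    refine ⟨fun t => g⁻¹ * F t, by simp [F0], by simp [F1], ?_, ?_⟩
    · exact (g : X ≃ₜ X).symm.continuous.comp hF
    · exact hF'.comp (continuous_fst.prodMk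
        ((g : X ≃ₜ X).continuous.comp continuous_snd))

end MappingClassGroup

/-! ### The Klein bottle with one hole -/

namespace KleinHole

/-- A pair of pants: the closed disc of radius `5` about `0` minus the open discs of radius `1`
about `2` and `-2`. -/
def pants : Set ℂ := {z | ‖z‖ ≤ 5 ∧ 1 ≤ ‖z - 2‖ ∧ 1 ≤ ‖z + 2‖}

/-- The two inner boundary circles of the pair of pants. -/
def seam : Set ℂ := {z | ‖z - 2‖ = 1 ∨ ‖z + 2‖ = 1}

theorem neg_mem_seam {z : ℂ} (h : z ∈ seam) : -z ∈ seam := by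
  have h1 : ‖-z - 2‖ = ‖z + 2‖ := by rw [← norm_neg]; congr 1; ring
  have h2 : ‖-z + 2‖ = ‖z - 2‖ := by rw [← norm_neg]; congr 1; ring
  simp only [seam, Set.mem_ofPred_eq, h1, h2] at h ⊢
  exact h.symm

theorem neg_mem_pants {z : ℂ} (h : z ∈ pants) : -z ∈ pants := by
  have h1 : ‖-z - 2‖ = ‖z + 2‖ := by rw [← norm_neg]; congr 1; ring
  have h2 : ‖-z + 2‖ = ‖z - 2‖ := by rw [← norm_neg]; congr 1; ring
  simp only [pants, Set.mem_ofPred_eq, h1, h2, norm_neg] at h ⊢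
  exact ⟨h.1, h.2.2, h.2.1⟩

/-- Glue the two inner boundary circles to each other by `z ↦ -z`. -/
def glue : Setoid pants where
  r z w := (z : ℂ) = w ∨ ((z : ℂ) ∈ seam ∧ (w : ℂ) = -z)
  iseqv :=
    { refl := fun _ => Or.inl rfl
      symm := by
        rintro z w (h | ⟨h, h'⟩)
        · exact Or.inl h.symm
        · exact Or.inr ⟨h' ▸ neg_mem_seam h, by rw [h', neg_neg]⟩
      trans := by
        rintro x y z (h | ⟨h, h'⟩) (k | ⟨k, k'⟩)
        · exact Or.inl (h.trans k)
        · exact Or.inr ⟨h ▸ k, by rw [k', h]⟩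
        · exact Or.inr ⟨h, by rw [← k, h']⟩
        · exact Or.inl (by rw [k', h', neg_neg]) }

/-- The Klein bottle with one hole, i.e. the nonorientable surface of genus two with one boundary
component, cut open along its two-sided curve `α`.  The gluing `z ↦ -z` is a rotation, so it
identifies the two inner boundary circles of the pair of pants compatibly with their boundary
orientations, and the quotient is nonorientable.  The two inner circles become one two-sided simple
closed curve `α`; the segment `[-1, 1]` becomes a one-sided simple closed curve that meets `α`
transversely at one point, and `K` is a regular neighbourhood of the union of these two curves. -/
def K : Type := Quotient glue

instance : TopologicalSpace K := inferInstanceAs (TopologicalSpace (Quotient glue))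

/-- The projection of the pair of pants onto `K`. -/
def toK (z : pants) : K := Quotient.mk glue z

/-- The boundary circle of `K`. -/
def bdry : Set K := toK '' {z | ‖(z : ℂ)‖ = 5}

/-- The mapping class group of the Klein bottle with one hole. -/
abbrev MapK : Type := MappingClassGroup K bdry

/-- A homeomorphism of the plane that preserves the pair of pants and the gluing induces a
homeomorphism of `K`. -/
noncomputable def descend (f : ℂ ≃ₜ ℂ) (hP : ∀ z, z ∈ pants ↔ f z ∈ pants) (hS : ∀ z, z ∈ seam ↔ f z ∈ seam)
    (hneg : ∀ z ∈ seam, f (-z) = -f z) : K ≃ₜ K where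
  toEquiv := Quotient.congr (f.subtype hP).toEquiv (by
    intro z w
    change ((z : ℂ) = w ∨ ((z : ℂ) ∈ seam ∧ (w : ℂ) = -z)) ↔
      (f z = f w ∨ (f z ∈ seam ∧ f w = -f z))
    rw [f.injective.eq_iff, ← hS]
    refine or_congr Iff.rfl (and_congr_right fun hz => ?_)
    rw [← hneg _ hz, f.injective.eq_iff])
  continuous_toFun :=
    Continuous.quotient_lift (continuous_quotient_mk'.comp (f.subtype hP).continuous) _
  continuous_invFun :=
    Continuous.quotient_lift (continuous_quotient_mk'.comp (f.subtype hP).symm.continuous) _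

theorem descend_toK (f : ℂ ≃ₜ ℂ) (hP : ∀ z, z ∈ pants ↔ f z ∈ pants)
    (hS : ∀ z, z ∈ seam ↔ f z ∈ seam) (hneg : ∀ z ∈ seam, f (-z) = -f z) (z : pants) :
    descend f hP hS hneg (toK z) = toK ⟨f z, (hP z).1 z.2⟩ := rfl

/-! ### Twists of the plane -/

/-- The map that rotates each circle of radius `s` about `c` by the angle `g s`. -/
noncomputable def twistFun (c : ℂ) (g : ℝ → ℝ) (z : ℂ) : ℂ :=
  c + (z - c) * Complex.exp (g ‖z - c‖ * Complex.I)

theorem norm_twistFun_sub (c : ℂ) (g : ℝ → ℝ) (z : ℂ) : ‖twistFun c g z - c‖ = ‖z - c‖ := by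
  simp [twistFun, Complex.norm_exp_ofReal_mul_I]

theorem twistFun_neg_twistFun (c : ℂ) (g : ℝ → ℝ) (z : ℂ) :
    twistFun c (-g) (twistFun c g z) = z := by
  have h := norm_twistFun_sub c g z
  rw [twistFun, h, twistFun, add_sub_cancel_left, mul_assoc, ← Complex.exp_add]
  simp

theorem continuous_twistFun (c : ℂ) (g : ℝ → ℝ) (hg : Continuous g) :
    Continuous (twistFun c g) := by
  unfold twistFun
  fun_prop

/-- `twistFun` as a homeomorphism of the plane. -/
noncomputable def twist (c : ℂ) (g : ℝ → ℝ) (hg : Continuous g) : ℂ ≃ₜ ℂ where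
  toFun := twistFun c g
  invFun := twistFun c (-g)
  left_inv := twistFun_neg_twistFun c g
  right_inv z := by simpa using twistFun_neg_twistFun c (-g) z
  continuous_toFun := continuous_twistFun c g hg
  continuous_invFun := continuous_twistFun c (-g) hg.neg

theorem twistFun_eq_self {c : ℂ} {g : ℝ → ℝ} {z : ℂ} (h : g ‖z - c‖ = 0) :
    twistFun c g z = z := by
  simp [twistFun, h]

/-- The function that is `0` on `(-∞, a]`, `1` on `[a + 1, ∞)` and linear in between. -/
noncomputable def ramp (a s : ℝ) : ℝ := max 0 (min 1 (s - a))

theorem continuous_ramp (a : ℝ) : Continuous (ramp a) := by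
  unfold ramp
  fun_prop

theorem ramp_eq_zero {a s : ℝ} (h : s ≤ a) : ramp a s = 0 :=
  max_eq_left ((min_le_right _ _).trans (sub_nonpos.2 h))

theorem ramp_eq_one {a s : ℝ} (h : a + 1 ≤ s) : ramp a s = 1 := by
  rw [ramp, min_eq_left (by linarith)]
  norm_num

/-! ### The `Y`-homeomorphism -/

/-- The homeomorphism `r` of `K` induced by `z ↦ -z`, the reflection of `K` through `α`: it fixes
`α` pointwise, interchanges the two sides of `α`, and rotates the boundary circle by `π`. -/
noncomputable def reflection : K ≃ₜ K :=
  descend (Homeomorph.neg ℂ)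
    (fun z => ⟨neg_mem_pants, fun h => by simpa using neg_mem_pants h⟩)
    (fun z => ⟨neg_mem_seam, fun h => by simpa using neg_mem_seam h⟩)
    (by intro z _; simp)

/-- The angle of the half twist on the circle of radius `s`: it is `0` for `s ≤ 4` and grows
(or decreases, according to the sign `ε`) to `± π` at the boundary `s = 5`. -/
noncomputable def halfProfile (ε : ℤˣ) (s : ℝ) : ℝ := ((ε : ℤ) : ℝ) * (Real.pi * ramp 4 s)

theorem continuous_halfProfile (ε : ℤˣ) : Continuous (halfProfile ε) :=
  continuous_const.mul (continuous_const.mul (continuous_ramp 4))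

theorem halfProfile_neg (ε : ℤˣ) : halfProfile (-ε) = -halfProfile ε := by
  ext s
  simp [halfProfile]

theorem twistFun_half_eq_self (ε : ℤˣ) {z : ℂ} (h : ‖z‖ ≤ 4) :
    twistFun 0 (halfProfile ε) z = z :=
  twistFun_eq_self (by simp [halfProfile, ramp_eq_zero h])

theorem norm_le_of_mem_seam {z : ℂ} (h : z ∈ seam) : ‖z‖ ≤ 4 := by
  have e2 : ‖(2 : ℂ)‖ = 2 := by simp
  rcases h with h | h
  · have := norm_add_le (z - 2) 2
    rw [sub_add_cancel, h, e2] at this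
    linarith
  · have := norm_sub_le (z + 2) 2
    rw [add_sub_cancel_right, h, e2] at this
    linarith

theorem half_norm (ε : ℤˣ) (z : ℂ) : ‖twistFun 0 (halfProfile ε) z‖ = ‖z‖ := by
  simpa using norm_twistFun_sub 0 (halfProfile ε) z

theorem half_inv (ε : ℤˣ) (z : ℂ) :
    twistFun 0 (halfProfile (-ε)) (twistFun 0 (halfProfile ε) z) = z := by
  rw [halfProfile_neg]
  exact twistFun_neg_twistFun _ _ _

theorem half_pants (ε : ℤˣ) {z : ℂ} (h : z ∈ pants) :
    twistFun 0 (halfProfile ε) z ∈ pants := by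
  by_cases hz : ‖z‖ ≤ 4
  · rwa [twistFun_half_eq_self ε hz]
  · push Not at hz
    have e2 : ‖(2 : ℂ)‖ = 2 := by simp
    have hw := half_norm ε z
    set w := twistFun 0 (halfProfile ε) z
    have h1 := norm_add_le (w - 2) 2
    have h2 := norm_sub_le (w + 2) 2
    rw [sub_add_cancel, e2] at h1
    rw [add_sub_cancel_right, e2] at h2
    exact ⟨hw ▸ h.1, by linarith, by linarith⟩

theorem half_seam (ε : ℤˣ) {z : ℂ} (h : z ∈ seam) :
    twistFun 0 (halfProfile ε) z ∈ seam := by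
  rwa [twistFun_half_eq_self ε (norm_le_of_mem_seam h)]

/-- The two half twists (one for each sign `ε`) around the boundary of `K`, supported in the
collar `4 ≤ ‖z‖ ≤ 5`; they rotate the boundary circle by `± π`. -/
noncomputable def halfTwist (ε : ℤˣ) : K ≃ₜ K :=
  descend (twist 0 (halfProfile ε) (continuous_halfProfile ε))
    (fun z => ⟨half_pants ε, fun h => by
      rw [← half_inv ε z]; exact half_pants (-ε) h⟩)
    (fun z => ⟨half_seam ε, fun h => by
      rw [← half_inv ε z]; exact half_seam (-ε) h⟩)
    (fun z hz => by
      change twistFun _ _ _ = -twistFun _ _ _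
      rw [twistFun_half_eq_self ε (norm_le_of_mem_seam hz),
        twistFun_half_eq_self ε (norm_le_of_mem_seam (neg_mem_seam hz))])

theorem exp_sign_pi (ε : ℤˣ) :
    Complex.exp ((((ε : ℤ) : ℝ) * Real.pi : ℝ) * Complex.I) = -1 := by
  rcases Int.units_eq_one_or ε with rfl | rfl
  · simp
  · simp [Complex.exp_neg]

theorem halfTwist_reflection_mem (ε : ℤˣ) : halfTwist ε * reflection ∈ HomeoRel K bdry := by
  rintro _ ⟨z, hz, rfl⟩
  have hz : ‖(z : ℂ)‖ = 5 := hz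
  change halfTwist ε (reflection (toK z)) = toK z
  rw [reflection, descend_toK, halfTwist, descend_toK]
  congr 1
  apply Subtype.ext
  change twistFun 0 (halfProfile ε) (-(z : ℂ)) = z
  have hp : halfProfile ε 5 = ((ε : ℤ) : ℝ) * Real.pi := by
    rw [halfProfile, ramp_eq_one (by norm_num), mul_one]
  rw [twistFun, sub_zero, norm_neg, hz, hp, exp_sign_pi]
  ring

/-- The `Y`-homeomorphism as a homeomorphism fixing the boundary: the reflection through `α`
followed by one of the two half twists around the boundary. -/
noncomputable def yHomeo (ε : ℤˣ) : HomeoRel K bdry :=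
  ⟨halfTwist ε * reflection, halfTwist_reflection_mem ε⟩

/-- The mapping class of the `Y`-homeomorphism. -/
noncomputable def y (ε : ℤˣ) : MapK := (yHomeo ε : MapK)

/-! ### The Dehn twist about `α` -/

/-- An angle that decreases from `π` (for `s ≤ 1`) to `0` (for `2 ≤ s`), up to the sign `δ`. -/
noncomputable def dehnProfile (δ : ℤˣ) (s : ℝ) : ℝ :=
  ((δ : ℤ) : ℝ) * (Real.pi * (1 - ramp 1 s))

theorem continuous_dehnProfile (δ : ℤˣ) : Continuous (dehnProfile δ) :=
  continuous_const.mul (continuous_const.mul (continuous_const.sub (continuous_ramp 1)))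

theorem dehnProfile_neg (δ : ℤˣ) : dehnProfile (-δ) = -dehnProfile δ := by
  ext s
  simp [dehnProfile]

theorem dehnProfile_eq_zero (δ : ℤˣ) {s : ℝ} (h : 2 ≤ s) : dehnProfile δ s = 0 := by
  rw [dehnProfile, ramp_eq_one (by linarith)]
  ring

theorem dehnProfile_one (δ : ℤˣ) : dehnProfile δ 1 = ((δ : ℤ) : ℝ) * Real.pi := by
  rw [dehnProfile, ramp_eq_zero le_rfl]
  ring

theorem four_le_norm_add (w : ℂ) : 4 ≤ ‖w - 2‖ + ‖w + 2‖ := by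
  have h := norm_sub_le (w + 2) (w - 2)
  have e : w + 2 - (w - 2) = 4 := by ring
  have e4 : ‖(4 : ℂ)‖ = 4 := by simp
  rw [e, e4] at h
  linarith

theorem right_inv (δ : ℤˣ) (z : ℂ) :
    twistFun 2 (dehnProfile (-δ)) (twistFun 2 (dehnProfile δ) z) = z := by
  rw [dehnProfile_neg]
  exact twistFun_neg_twistFun _ _ _

theorem left_inv (δ : ℤˣ) (z : ℂ) :
    twistFun (-2) (dehnProfile (-δ)) (twistFun (-2) (dehnProfile δ) z) = z := by
  rw [dehnProfile_neg]
  exact twistFun_neg_twistFun _ _ _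

theorem right_eq_self (δ : ℤˣ) {z : ℂ} (h : 2 ≤ ‖z - 2‖) : twistFun 2 (dehnProfile δ) z = z :=
  twistFun_eq_self (dehnProfile_eq_zero δ h)

theorem left_eq_self (δ : ℤˣ) {z : ℂ} (h : 2 ≤ ‖z + 2‖) : twistFun (-2) (dehnProfile δ) z = z :=
  twistFun_eq_self (dehnProfile_eq_zero δ (by rwa [sub_neg_eq_add]))

theorem right_pants (δ : ℤˣ) {z : ℂ} (h : z ∈ pants) : twistFun 2 (dehnProfile δ) z ∈ pants := by
  rcases le_total 2 ‖z - 2‖ with hz | hz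
  · rwa [right_eq_self δ hz]
  · have hw := norm_twistFun_sub 2 (dehnProfile δ) z
    set w := twistFun 2 (dehnProfile δ) z
    have h1 := norm_add_le (w - 2) 2
    have e2 : ‖(2 : ℂ)‖ = 2 := by simp
    rw [sub_add_cancel, e2] at h1
    have h4 := four_le_norm_add w
    exact ⟨by linarith, by linarith [h.2.1], by linarith⟩

theorem left_pants (δ : ℤˣ) {z : ℂ} (h : z ∈ pants) :
    twistFun (-2) (dehnProfile δ) z ∈ pants := by
  rcases le_total 2 ‖z + 2‖ with hz | hz
  · rwa [left_eq_self δ hz]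
  · have hw := norm_twistFun_sub (-2) (dehnProfile δ) z
    simp only [sub_neg_eq_add] at hw
    set w := twistFun (-2) (dehnProfile δ) z
    have h1 := norm_sub_le (w + 2) 2
    have e2 : ‖(2 : ℂ)‖ = 2 := by simp
    rw [add_sub_cancel_right, e2] at h1
    have h4 := four_le_norm_add w
    exact ⟨by linarith, by linarith, by linarith [h.2.2]⟩

theorem right_seam (δ : ℤˣ) {z : ℂ} (h : z ∈ seam) : twistFun 2 (dehnProfile δ) z ∈ seam := by
  rcases h with h | h
  · exact Or.inl (by rw [norm_twistFun_sub, h])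
  · rw [right_eq_self δ (by linarith [four_le_norm_add z])]
    exact Or.inr h

theorem left_seam (δ : ℤˣ) {z : ℂ} (h : z ∈ seam) : twistFun (-2) (dehnProfile δ) z ∈ seam := by
  rcases h with h | h
  · rw [left_eq_self δ (by linarith [four_le_norm_add z])]
    exact Or.inl h
  · refine Or.inr ?_
    have := norm_twistFun_sub (-2) (dehnProfile δ) z
    simp only [sub_neg_eq_add] at this
    rw [this, h]

/-- The twist of the annulus `1 ≤ ‖z - 2‖ ≤ 2` by the angle `δ π` on the circle `‖z - 2‖ = 1`,
followed by the twist of the annulus `1 ≤ ‖z + 2‖ ≤ 2` by the angle `-δ π` on the circle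
`‖z + 2‖ = 1`. -/
noncomputable def dehnPlane (δ : ℤˣ) : ℂ ≃ₜ ℂ :=
  (twist 2 (dehnProfile δ) (continuous_dehnProfile δ)).trans
    (twist (-2) (dehnProfile (-δ)) (continuous_dehnProfile (-δ)))

theorem dehnPlane_apply (δ : ℤˣ) (z : ℂ) :
    dehnPlane δ z = twistFun (-2) (dehnProfile (-δ)) (twistFun 2 (dehnProfile δ) z) := rfl

theorem dehnPlane_right (δ : ℤˣ) {z : ℂ} (h : ‖z - 2‖ = 1) : dehnPlane δ z = 4 - z := by
  have e : twistFun 2 (dehnProfile δ) z = 4 - z := by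
    rw [twistFun, h, dehnProfile_one, exp_sign_pi]
    ring
  have h1 : ‖(4 - z) - 2‖ = 1 := by rw [← h, ← norm_neg]; congr 1; ring
  rw [dehnPlane_apply, e, left_eq_self _ (by linarith [four_le_norm_add (4 - z)])]

theorem dehnPlane_left (δ : ℤˣ) {z : ℂ} (h : ‖z + 2‖ = 1) : dehnPlane δ z = -4 - z := by
  rw [dehnPlane_apply, right_eq_self _ (by linarith [four_le_norm_add z]), twistFun,
    sub_neg_eq_add, h, dehnProfile_one, exp_sign_pi]
  ring

/-- The Dehn twist about `α` as a homeomorphism of `K`, supported in the annulus around `α` formed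
by `1 ≤ ‖z - 2‖ ≤ 2` and `1 ≤ ‖z + 2‖ ≤ 2`.  Crossing the annulus from one boundary component
through `α` to the other, the rotation angle changes monotonically by a total of `2 π`, one half
on each side of `α`; the sign `δ` is the direction of the twist. -/
noncomputable def dehnK (δ : ℤˣ) : K ≃ₜ K :=
  descend (dehnPlane δ)
    (fun z => ⟨fun h => left_pants _ (right_pants _ h), fun h => by
      have := right_pants (-δ) (left_pants δ h)
      rw [dehnPlane_apply] at this
      have e := left_inv (-δ) (twistFun 2 (dehnProfile δ) z)
      rw [neg_neg] at e
      rwa [e, right_inv] at this⟩)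
    (fun z => ⟨fun h => left_seam _ (right_seam _ h), fun h => by
      have := right_seam (-δ) (left_seam δ h)
      rw [dehnPlane_apply] at this
      have e := left_inv (-δ) (twistFun 2 (dehnProfile δ) z)
      rw [neg_neg] at e
      rwa [e, right_inv] at this⟩)
    (by
      rintro z (h | h)
      · have h' : ‖-z + 2‖ = 1 := by rw [← h, ← norm_neg]; congr 1; ring
        rw [dehnPlane_right δ h, dehnPlane_left δ h']
        ring
      · have h' : ‖-z - 2‖ = 1 := by rw [← h, ← norm_neg]; congr 1; ring
        rw [dehnPlane_left δ h, dehnPlane_right δ h']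
        ring)

theorem dehnK_mem (δ : ℤˣ) : dehnK δ ∈ HomeoRel K bdry := by
  rintro _ ⟨z, hz, rfl⟩
  have hz : ‖(z : ℂ)‖ = 5 := hz
  rw [dehnK, descend_toK]
  congr 1
  apply Subtype.ext
  change dehnPlane δ z = z
  have e2 : ‖(2 : ℂ)‖ = 2 := by simp
  have h1 := norm_add_le ((z : ℂ) - 2) 2
  have h2 := norm_sub_le ((z : ℂ) + 2) 2
  rw [sub_add_cancel, e2] at h1
  rw [add_sub_cancel_right, e2] at h2
  rw [dehnPlane_apply, right_eq_self δ (by linarith), left_eq_self _ (by linarith)]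

/-- The Dehn twist `t_α` as a homeomorphism fixing the boundary. -/
noncomputable def tHomeo (δ : ℤˣ) : HomeoRel K bdry := ⟨dehnK δ, dehnK_mem δ⟩

/-- The mapping class `t_α` of the Dehn twist about `α`. -/
noncomputable def t (δ : ℤˣ) : MapK := (tHomeo δ : MapK)

/-- The crosscap transposition `u = t_α⁻¹ y`. -/
noncomputable def u (δ ε : ℤˣ) : MapK := (t δ)⁻¹ * y ε

end KleinHole

/-! ### The geometric relation between the Dehn twist and the `Y`-homeomorphism. -/

namespace KleinHole

/-! Write `t`, `y` for the two mapping classes. Everything follows from the relation `y t y⁻¹ =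
t⁻¹`. It holds because the reflection `z ↦ -z` swaps the two halves of the annulus around `α` while
preserving the sense of rotation; the Dehn twist rotates the two halves in opposite senses, so the
reflection conjugates it to its inverse. The half twist in `y` lives near the boundary and commutes
with `t`. This is proved in the form `t y t = y`, as an equality of homeomorphisms
(`tHomeo_mul_yHomeo_mul_tHomeo`), so no isotopy has to be built. The rest is algebra: an odd power
`c` of `y` still inverts `t`, and then `t ^ k (t ^ j c) t ^ (-k) = t ^ (j + 2 k) c`. Hence the
conjugacy class of `t ^ j c` depends only on the parity of `j`; the representatives `j = 0` and `j =
-1` give the two claims. -/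

theorem neg_twistFun (c : ℂ) (g : ℝ → ℝ) (z : ℂ) : -twistFun c g z = twistFun (-c) g (-z) := by
  have h : ‖-z - -c‖ = ‖z - c‖ := by rw [← norm_neg]; congr 1; ring
  rw [twistFun, twistFun, h]
  ring

/-- Negation exchanges the centres `2` and `-2` and keeps the angles. The resulting product has both
the order and the signs of `(dehnPlane δ)⁻¹`, so it cancels against `dehnPlane δ` without commuting
the two twists. -/
theorem neg_dehnPlane (δ : ℤˣ) (z : ℂ) :
    -dehnPlane δ z = twistFun 2 (dehnProfile (-δ)) (twistFun (-2) (dehnProfile δ) (-z)) := by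
  rw [dehnPlane_apply, neg_twistFun, neg_twistFun, neg_neg]

/-- Conjugation by `z ↦ -z` inverts the Dehn twist. -/
theorem dehnPlane_neg_dehnPlane (δ : ℤˣ) (z : ℂ) : dehnPlane δ (-dehnPlane δ z) = -z := by
  have h := right_inv (-δ) (twistFun (-2) (dehnProfile δ) (-z))
  rw [neg_neg] at h
  rw [neg_dehnPlane, dehnPlane_apply, h, left_inv]

theorem dehnPlane_eq_self (δ : ℤˣ) {z : ℂ} (h : 4 ≤ ‖z‖) : dehnPlane δ z = z := by
  have e2 : ‖(2 : ℂ)‖ = 2 := by simp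
  have h1 := norm_add_le (z - 2) 2
  have h2 := norm_sub_le (z + 2) 2
  rw [sub_add_cancel, e2] at h1
  rw [add_sub_cancel_right, e2] at h2
  rw [dehnPlane_apply, right_eq_self δ (by linarith), left_eq_self _ (by linarith)]

/-- An image point outside the disc would be fixed, so by injectivity it would equal `z`, which lies
inside. -/
theorem norm_dehnPlane_le (δ : ℤˣ) {z : ℂ} (h : ‖z‖ ≤ 4) : ‖dehnPlane δ z‖ ≤ 4 := by
  by_contra hw
  have e := (dehnPlane δ).injective (dehnPlane_eq_self δ (not_le.1 hw).le)
  exact hw (e.symm ▸ h)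

/-- The half twist commutes with the Dehn twist, since their supports are disjoint. -/
theorem dehnPlane_half (δ ε : ℤˣ) (z : ℂ) :
    dehnPlane δ (twistFun 0 (halfProfile ε) z) = twistFun 0 (halfProfile ε) (dehnPlane δ z) := by
  -- Both maps preserve the two sides of the circle of radius `4`, and on each side one of them is
  -- the identity.
  rcases le_total ‖z‖ 4 with h | h
  · rw [twistFun_half_eq_self ε h, twistFun_half_eq_self ε (norm_dehnPlane_le δ h)]
  · rw [dehnPlane_eq_self δ h, dehnPlane_eq_self δ (by rwa [half_norm])]

theorem tHomeo_mul_yHomeo_mul_tHomeo (δ ε : ℤˣ) :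
    tHomeo δ * yHomeo ε * tHomeo δ = yHomeo ε := by
  apply Subtype.ext
  apply Homeomorph.ext
  intro x
  obtain ⟨z, rfl⟩ : ∃ z, toK z = x := Quotient.exists_rep x
  change dehnK δ (halfTwist ε (reflection (dehnK δ (toK z)))) = halfTwist ε (reflection (toK z))
  simp only [dehnK, halfTwist, reflection, descend_toK]
  congr 1
  apply Subtype.ext
  change dehnPlane δ (twistFun 0 (halfProfile ε) (-dehnPlane δ z)) =
    twistFun 0 (halfProfile ε) (-(z : ℂ))
  rw [dehnPlane_half, dehnPlane_neg_dehnPlane]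

/-- The `Y`-homeomorphism conjugates `t_α` to its inverse. -/
theorem semiconjBy_y_t (δ ε : ℤˣ) : SemiconjBy (y ε) (t δ) (t δ)⁻¹ := by
  have h : t δ * y ε * t δ = y ε :=
    congrArg (fun f : HomeoRel K bdry => (f : MapK)) (tHomeo_mul_yHomeo_mul_tHomeo δ ε)
  rw [SemiconjBy, eq_inv_mul_iff_mul_eq, ← mul_assoc, h]

end KleinHole

/-! ### Group theory of an element inverted by another. -/

section InvertedElement

variable {G : Type*} [Group G] {a b : G}

/-- Inverting twice does nothing, so `b * b` and its powers commute with `a`; one factor `b`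
remains. -/
theorem SemiconjBy.zpow_odd_of_inv (h : SemiconjBy b a a⁻¹) (n : ℤ) :
    SemiconjBy (b ^ (2 * n + 1)) a a⁻¹ := by
  have h2 : Commute (b * b) a := by
    have h' := h.inv_right
    rw [inv_inv] at h'
    exact h'.mul_left h
  have h3 : SemiconjBy ((b * b) ^ n) a a := h2.zpow_left n
  rw [zpow_add, zpow_one, zpow_mul, zpow_two]
  exact h3.inv_right.mul_left h

/-- If `c` inverts `a`, then conjugation by `a ^ k` multiplies `a ^ j * c` by `a ^ (2 * k)`. -/
theorem isConj_zpow_mul_of_inv {c : G} (h : SemiconjBy c a a⁻¹) (j k : ℤ) :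
    IsConj (a ^ (j + 2 * k) * c) (a ^ j * c) := by
  refine IsConj.symm (isConj_iff.2 ⟨a ^ k, ?_⟩)
  -- Moving `a ^ (-k)` leftwards past `c` turns it into a second `a ^ k`, hence the `2 * k`.
  have h' : c * (a ^ k)⁻¹ = a ^ k * c := by
    simpa using (h.zpow_right (-k)).eq
  rw [mul_assoc, mul_assoc, h', ← mul_assoc, ← mul_assoc, ← zpow_add, ← zpow_add]
  congr 2
  ring

end InvertedElement

theorem mainTheorem12 (δ ε : ℤˣ) (m n : ℤ) :
    IsConj (KleinHole.t δ ^ (2 * m) * KleinHole.y ε ^ (2 * n + 1))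
      (KleinHole.y ε ^ (2 * n + 1)) ∧
    IsConj (KleinHole.t δ ^ (2 * m + 1) * KleinHole.y ε ^ (2 * n + 1))
      (KleinHole.u δ ε * KleinHole.y ε ^ (2 * n)) := by
  have h := (KleinHole.semiconjBy_y_t δ ε).zpow_odd_of_inv n
  constructor
  · simpa using isConj_zpow_mul_of_inv h 0 m
  -- The odd representative is `j = -1` because `t⁻¹ * y` is `u` by definition; `k = m + 1` then
  -- brings the exponent to `2 * m + 1`.
  · have h1 := isConj_zpow_mul_of_inv h (-1) (m + 1)
    have e : -1 + 2 * (m + 1) = 2 * m + 1 := by ring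
    -- One factor `y` is split off `y ^ (2 * n + 1)` to form `t⁻¹ * y` on the right, and the power
    -- on the left is then reassembled.
    rwa [e, zpow_neg_one, add_comm (2 * n) 1, zpow_one_add, ← mul_assoc (KleinHole.t δ)⁻¹,
      ← zpow_one_add, add_comm 1 (2 * n)] at h1
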